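/- Let $n,N\ge 1$ be integers, let $\mathcal X\subset\mathbb R^n$ be a convex compact set with non-empty interior, let $c\in\mathbb R^n$, and put $f^*=\min_{x\in\mathcal X}c^Tx$. Consider the randomized cutting-plane (RCP) method with $N$ samples per iteration: start with $\mathcal X_0=\mathcal X$ and, for $k=0,1,2,\dots$, draw points $x_k^{(1)},\dots,x_k^{(N)}$ which, conditionally on all samples of the earlier iterations, are independent and uniformly distributed on $\mathcal X_k$; let $z_k$ be a point of $\{x_k^{(1)},\dots,x_k^{(N)}\}$ with the smallest value of $c^Tx$; and put $\mathcal X_{k+1}=\{x\in\mathcal X_k: c^T(x-z_k)\le 0\}$. Let $f_k=c^Tz_k$. Then for every $k\ge 0$ the random variables $f_k-f^*$ and $(f_k-f^*)^2$ are integrable, and $$\mathbb E[f_k-f^*]\le\Big(\frac1{N+1}\Big)^{k/n}\,\mathbb E[f_0-f^*].$$ If moreover $n\ge 2$, then for every $k\ge0$ $$\mathbb E[(f_k-f^*)^2]\le\Big(\frac1{N+1}\Big)^{2k/n}\,\mathbb E[(f_0-f^*)^2].$$ -/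

import Mathlib

open MeasureTheory ProbabilityTheory

/-- The successive bodies of a cutting-plane run for the objective `x ↦ ⟪c, x⟫` on `X`:
the first body is `X`, and the `k`-th body is cut at the point `z k`, keeping the points whose
objective value is at most that of `z k`. -/
def cutBody {n : ℕ} (c : EuclideanSpace ℝ (Fin n)) (X : Set (EuclideanSpace ℝ (Fin n)))
    (z : ℕ → EuclideanSpace ℝ (Fin n)) : ℕ → Set (EuclideanSpace ℝ (Fin n))
  | 0 => X
  | k + 1 => {x ∈ cutBody c X z k | inner ℝ c (x - z k) ≤ 0}

/-- The σ-algebra generated by the samples drawn in the iterations before iteration `k`. -/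
abbrev samplePast {Ω : Type*} {n N : ℕ} (sample : ℕ → Ω → Fin N → EuclideanSpace ℝ (Fin n))
    (k : ℕ) : MeasurableSpace Ω :=
  ⨆ j ∈ Set.Iio k, MeasurableSpace.comap (sample j) inferInstance

/-- A run of the randomized cutting-plane method with `N` samples per iteration, for minimizing
`⟪c, x⟫` over `X`. In iteration `k`, the points `sample k · 0, …, sample k · (N - 1)` are drawn
and `z k` is the best of them. -/
structure IsRCPRun {Ω : Type*} [MeasurableSpace Ω] {n N : ℕ} (c : EuclideanSpace ℝ (Fin n))
    (X : Set (EuclideanSpace ℝ (Fin n))) (P : Measure Ω)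
    (sample : ℕ → Ω → Fin N → EuclideanSpace ℝ (Fin n))
    (z : ℕ → Ω → EuclideanSpace ℝ (Fin n)) : Prop where
  measurable_sample : ∀ k, Measurable (sample k)
  /-- Conditionally on the past, the `N` samples of iteration `k` are independent and uniformly
  distributed on the current body. Here `volume[|S]` is Lebesgue measure normalized on `S`. -/
  sample_law : ∀ (k : ℕ) (B : Set (Fin N → EuclideanSpace ℝ (Fin n))), MeasurableSet B →
    P⟦sample k ⁻¹' B | samplePast sample k⟧ =ᵐ[P]
      fun ω => (Measure.pi fun _ : Fin N =>
        (volume : Measure (EuclideanSpace ℝ (Fin n)))[|cutBody c X (fun j => z j ω) k]).real B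
  /-- `z k` is one of the samples of iteration `k`. -/
  z_mem : ∀ k ω, ∃ i, z k ω = sample k ω i
  /-- `z k` has the least objective value among the samples of iteration `k`. -/
  z_le : ∀ k ω i, inner ℝ c (z k ω) ≤ inner ℝ c (sample k ω i)

/-- The optimal value `f* = min_{x ∈ X} ⟪c, x⟫` (attained when `X` is compact and nonempty). -/
noncomputable def optValue {n : ℕ} (c : EuclideanSpace ℝ (Fin n))
    (X : Set (EuclideanSpace ℝ (Fin n))) : ℝ :=
  sInf ((fun x => inner ℝ c x) '' X)

/-- The objective gap `f_k - f* = ⟪c, z_k⟫ - f*`. -/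
noncomputable def gap {Ω : Type*} {n : ℕ} (c : EuclideanSpace ℝ (Fin n))
    (X : Set (EuclideanSpace ℝ (Fin n))) (z : ℕ → Ω → EuclideanSpace ℝ (Fin n))
    (k : ℕ) (ω : Ω) : ℝ :=
  inner ℝ c (z k ω) - optValue c X

open Set

/-! ### Geometry of one cut -/

section Deterministic

variable {n : ℕ}

/-! Let `s` be the gap at `z k`. The next body is convex, lies at gap at most `s`, and contains a
minimizer `x₀` of the objective. Its contraction about `x₀` with ratio `t / s` stays inside it and
has gap at most `t`, so a uniform point has gap above `t` with probability at most `1 - (t / s) ^ n`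
(`cond_volume_gt_le`). The best of `N` samples has gap above `t` only if all do, which gives the
bound `(1 - (t / s) ^ n) ^ N`.

This is the tail of `s * M`, where `M` is the `n`-th root of the minimum of `N` uniform variables.
So the next gap is stochastically dominated by the current gap times an independent copy of `M`
(`measure_lt_gap_succ_le`), and its `p`-th moment shrinks by `E[M ^ p]`. For `p ≤ n`, Jensen gives
`E[M ^ p] ≤ (1 / (N + 1)) ^ (p / n)` (`integral_minRoot_pow_le`). Induction on `k` with `p = 1, 2`
concludes. -/

theorem cutBody_isCompact (c : EuclideanSpace ℝ (Fin n)) {X : Set (EuclideanSpace ℝ (Fin n))}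
    (hX : IsCompact X) (z : ℕ → EuclideanSpace ℝ (Fin n)) (k : ℕ) :
    IsCompact (cutBody c X z k) := by
  induction k with
  | zero => exact hX
  | succ k ih =>
    exact ih.inter_right (t := {x | inner ℝ c (x - z k) ≤ 0})
      (isClosed_le (by fun_prop) continuous_const)

theorem cutBody_convex (c : EuclideanSpace ℝ (Fin n)) {X : Set (EuclideanSpace ℝ (Fin n))}
    (hX : Convex ℝ X) (z : ℕ → EuclideanSpace ℝ (Fin n)) (k : ℕ) :
    Convex ℝ (cutBody c X z k) := by
  induction k with
  | zero => exact hX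
  | succ k ih =>
    refine ih.inter (t := {x | inner ℝ c (x - z k) ≤ 0}) ?_
    have : {x | inner ℝ c (x - z k) ≤ 0} = {x | inner ℝ c x ≤ inner ℝ c (z k)} := by
      ext x; simp [inner_sub_right]
    rw [this]
    exact convex_halfSpace_le (innerₛₗ ℝ c).isLinear _

theorem cutBody_subset (c : EuclideanSpace ℝ (Fin n)) (X : Set (EuclideanSpace ℝ (Fin n)))
    (z : ℕ → EuclideanSpace ℝ (Fin n)) (k : ℕ) : cutBody c X z k ⊆ X := by
  induction k with
  | zero => exact subset_rfl
  | succ k ih => exact fun x hx => ih hx.1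

/-- Cuts depend only on the objective value, so a minimizer over `X` survives in every nonempty
body. -/
theorem mem_cutBody_of_le {c : EuclideanSpace ℝ (Fin n)} {X : Set (EuclideanSpace ℝ (Fin n))}
    {z : ℕ → EuclideanSpace ℝ (Fin n)} {k : ℕ} {x y : EuclideanSpace ℝ (Fin n)}
    (hx : x ∈ X) (hy : y ∈ cutBody c X z k) (hxy : inner ℝ c x ≤ inner ℝ c y) :
    x ∈ cutBody c X z k := by
  induction k with
  | zero => exact hx
  | succ k ih =>
    refine ⟨ih hy.1, ?_⟩
    have := hy.2
    rw [inner_sub_right] at this ⊢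
    linarith

/-- In a convex body, a linear objective that is minimal at `x₀` and at most `s` above its minimum
exceeds the minimum by more than `t` with uniform probability at most `1 - (t / s) ^ n`. -/
theorem cond_volume_gt_le {c x₀ : EuclideanSpace ℝ (Fin n)} {S : Set (EuclideanSpace ℝ (Fin n))}
    (hconv : Convex ℝ S) (hS : IsCompact S) (hx₀ : x₀ ∈ S) {s t : ℝ} (ht : 0 < t) (hts : t < s)
    (hs : ∀ x ∈ S, inner ℝ c x - inner ℝ c x₀ ≤ s) :
    (volume : Measure (EuclideanSpace ℝ (Fin n)))[|S] {x | t < inner ℝ c x - inner ℝ c x₀}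
      ≤ ENNReal.ofReal (1 - (t / s) ^ n) := by
  have hs0 : 0 < s := ht.trans hts
  have hl0 : 0 ≤ t / s := by positivity
  have hl1 : t / s ≤ 1 := (div_le_one hs0).2 hts.le
  set T := AffineMap.homothety x₀ (t / s) '' S with hT
  have hTS : T ⊆ S := by
    rintro _ ⟨x, hx, rfl⟩
    rw [AffineMap.homothety_eq_lineMap]
    exact hconv.lineMap_mem hx₀ hx ⟨hl0, hl1⟩
  have hTt : ∀ y ∈ T, inner ℝ c y - inner ℝ c x₀ ≤ t := by
    rintro _ ⟨x, hx, rfl⟩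
    rw [AffineMap.homothety_apply, vsub_eq_sub, vadd_eq_add, inner_add_right, inner_smul_right,
      inner_sub_right, add_sub_cancel_right]
    calc t / s * (inner ℝ c x - inner ℝ c x₀) ≤ t / s * s := by gcongr; exact hs x hx
      _ = t := by field_simp
  have hTc : IsCompact T := hS.image (AffineMap.homothety_continuous _ _)
  have hvT : volume T = ENNReal.ofReal ((t / s) ^ n) * volume S := by
    rw [hT, Measure.addHaar_image_homothety, finrank_euclideanSpace_fin,
      abs_of_nonneg (pow_nonneg hl0 n)]
  rw [cond_apply hS.measurableSet]
  have hdiff : volume (S ∩ {x | t < inner ℝ c x - inner ℝ c x₀})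
      ≤ ENNReal.ofReal (1 - (t / s) ^ n) * volume S := by
    calc volume (S ∩ {x | t < inner ℝ c x - inner ℝ c x₀}) ≤ volume (S \ T) :=
          measure_mono fun x hx => ⟨hx.1, fun h => not_lt.2 (hTt x h) hx.2⟩
      _ = ENNReal.ofReal (1 - (t / s) ^ n) * volume S := by
          rw [measure_sdiff hTS hTc.measurableSet.nullMeasurableSet hTc.measure_lt_top.ne, hvT,
            ENNReal.ofReal_sub _ (pow_nonneg hl0 n), ENNReal.sub_mul, ENNReal.ofReal_one, one_mul]
          exact fun _ _ => hS.measure_lt_top.ne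
  calc (volume S)⁻¹ * volume (S ∩ {x | t < inner ℝ c x - inner ℝ c x₀})
      ≤ (volume S)⁻¹ * (ENNReal.ofReal (1 - (t / s) ^ n) * volume S) := by gcongr
    _ = ENNReal.ofReal (1 - (t / s) ^ n) * ((volume S)⁻¹ * volume S) := by ring
    -- Only `≤ 1` holds in general: the factor is `0` when `S` is null.
    _ ≤ ENNReal.ofReal (1 - (t / s) ^ n) * 1 := by gcongr; exact ENNReal.inv_mul_le_one _
    _ = _ := mul_one _

theorem exists_eq_optValue {c : EuclideanSpace ℝ (Fin n)} {X : Set (EuclideanSpace ℝ (Fin n))}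
    (hX : IsCompact X) (hne : X.Nonempty) :
    ∃ x₀ ∈ X, inner ℝ c x₀ = optValue c X ∧ ∀ x ∈ X, optValue c X ≤ inner ℝ c x := by
  obtain ⟨x₀, h₀, heq, hle⟩ := hX.exists_sInf_image_eq_and_le hne
    (f := fun x => inner ℝ c x) (by fun_prop)
  exact ⟨x₀, h₀, heq.symm, fun x hx => heq.le.trans (hle x hx)⟩

/-- The uniform probability, on a cut body, of a gap larger than `t`. -/
theorem cond_cutBody_gt_le {c : EuclideanSpace ℝ (Fin n)} {X : Set (EuclideanSpace ℝ (Fin n))}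
    (hconv : Convex ℝ X) (hX : IsCompact X) (hne : X.Nonempty)
    (z : ℕ → EuclideanSpace ℝ (Fin n)) (k : ℕ) {t : ℝ} (ht : 0 < t) :
    (volume : Measure (EuclideanSpace ℝ (Fin n)))[|cutBody c X z (k + 1)]
        {x | t < inner ℝ c x - optValue c X}
      ≤ if t < inner ℝ c (z k) - optValue c X then
          ENNReal.ofReal (1 - (t / (inner ℝ c (z k) - optValue c X)) ^ n) else 0 := by
  obtain ⟨x₀, hx₀, heq, hle⟩ := exists_eq_optValue (c := c) hX hne
  have hS := cutBody_isCompact c hX z (k + 1)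
  have hs : ∀ x ∈ cutBody c X z (k + 1), inner ℝ c x - optValue c X
      ≤ inner ℝ c (z k) - optValue c X := by
    intro x hx
    have := hx.2
    rw [inner_sub_right] at this
    linarith
  split_ifs with h
  -- For an arbitrary sequence `z` the body may be empty; the conditional measure is then zero.
  · rcases (cutBody c X z (k + 1)).eq_empty_or_nonempty with he | ⟨y, hy⟩
    · rw [he, cond_empty]; simp
    · have hmem := mem_cutBody_of_le hx₀ hy (heq.le.trans (hle y (cutBody_subset _ _ _ _ hy)))
      rw [← heq] at hs h ⊢
      exact cond_volume_gt_le (cutBody_convex c hconv z _) hS hmem ht h hs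
  · rw [cond_apply hS.measurableSet]
    have : cutBody c X z (k + 1) ∩ {x | t < inner ℝ c x - optValue c X} = ∅ := by
      ext x
      simp only [mem_empty_iff_false, iff_false]
      rintro ⟨hx, h'⟩
      exact h (h'.trans_le (hs x hx))
    simp [this]

end Deterministic

/-! ### The dominating factor: root of a minimum of uniforms -/

section MinimumOfUniforms

/-- The quantile transform `v ↦ (1 - v ^ (1 / N)) ^ (1 / n)` of the `n`-th root of the minimum of
`N` independent uniform variables. -/
noncomputable def minRoot (n N : ℕ) (v : ℝ) : ℝ := (1 - v ^ (1 / (N : ℝ))) ^ (1 / (n : ℝ))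

theorem measurable_minRoot (n N : ℕ) : Measurable (minRoot n N) := by
  unfold minRoot; fun_prop

theorem one_sub_rpow_mem {N : ℕ} {v : ℝ} (hv : v ∈ Ioo (0 : ℝ) 1) :
    1 - v ^ (1 / (N : ℝ)) ∈ Icc (0 : ℝ) 1 := by
  have h1 : v ^ (1 / (N : ℝ)) ≤ 1 := Real.rpow_le_one hv.1.le hv.2.le (by positivity)
  have h0 : 0 ≤ v ^ (1 / (N : ℝ)) := Real.rpow_nonneg hv.1.le _
  constructor <;> linarith

theorem lt_minRoot {n N : ℕ} (hn : n ≠ 0) (hN : N ≠ 0) {a v : ℝ} (ha : a ∈ Ioo (0 : ℝ) 1)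
    (hv : 0 < v) (hva : v < (1 - a ^ n) ^ N) : a < minRoot n N v := by
  have hn' : (0 : ℝ) < n := by positivity
  have hN' : (0 : ℝ) < N := by positivity
  have hb : 0 ≤ 1 - a ^ n := sub_nonneg.2 (pow_le_one₀ ha.1.le ha.2.le)
  have h1 : v ^ (1 / (N : ℝ)) < 1 - a ^ n := by
    have := Real.rpow_lt_rpow hv.le hva (one_div_pos.2 hN')
    rwa [one_div, Real.pow_rpow_inv_natCast hb hN, ← one_div] at this
  have h2 := Real.rpow_lt_rpow (pow_nonneg ha.1.le n) (show a ^ n < 1 - v ^ (1 / (N : ℝ)) by linarith)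
    (one_div_pos.2 hn')
  rwa [one_div, Real.pow_rpow_inv_natCast ha.1.le hn, ← one_div] at h2

theorem minRoot_mem {n N : ℕ} {v : ℝ} (hv : v ∈ Ioo (0 : ℝ) 1) :
    minRoot n N v ∈ Icc (0 : ℝ) 1 :=
  ⟨Real.rpow_nonneg (one_sub_rpow_mem hv).1 _,
    Real.rpow_le_one (one_sub_rpow_mem hv).1 (one_sub_rpow_mem hv).2 (by positivity)⟩

/-- Solving `a < minRoot n N v` for `v` gives `v < (1 - a ^ n) ^ N`. Only this lower bound on the
tail is needed for the domination. -/
theorem volume_lt_minRoot_ge {n N : ℕ} (hn : n ≠ 0) (hN : N ≠ 0) {a : ℝ}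
    (ha : a ∈ Ioo (0 : ℝ) 1) :
    ENNReal.ofReal (1 - a ^ n) ^ N
      ≤ volume.restrict (Ioo (0 : ℝ) 1) {v | a < minRoot n N v} := by
  have hb : 0 ≤ 1 - a ^ n := sub_nonneg.2 (pow_le_one₀ ha.1.le ha.2.le)
  have hb1 : (1 - a ^ n) ^ N ≤ 1 :=
    pow_le_one₀ hb (sub_le_self _ (pow_nonneg ha.1.le n))
  rw [Measure.restrict_apply (measurableSet_lt measurable_const (measurable_minRoot n N)),
    ← ENNReal.ofReal_pow hb]
  calc ENNReal.ofReal ((1 - a ^ n) ^ N) = volume (Ioo (0 : ℝ) ((1 - a ^ n) ^ N)) := by simp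
    _ ≤ volume ({v | a < minRoot n N v} ∩ Ioo (0 : ℝ) 1) := measure_mono fun v hv =>
      ⟨lt_minRoot hn hN ha hv.1 hv.2, hv.1, hv.2.trans_le hb1⟩

theorem integral_one_sub_rpow {N : ℕ} (hN : N ≠ 0) :
    ∫ v in Ioo (0 : ℝ) 1, (1 - v ^ (1 / (N : ℝ))) = 1 / ((N : ℝ) + 1) := by
  have hN' : (0 : ℝ) < N := by positivity
  have hq : (-1 : ℝ) < 1 / (N : ℝ) := lt_of_lt_of_le (by norm_num) (one_div_pos.2 hN').le
  rw [← integral_Ioc_eq_integral_Ioo, ← intervalIntegral.integral_of_le zero_le_one,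
    intervalIntegral.integral_sub (by simp) (intervalIntegral.intervalIntegrable_rpow' hq),
    integral_rpow (Or.inl hq)]
  rw [Real.one_rpow, Real.zero_rpow (by positivity)]
  simp
  field_simp
  ring

/-- Jensen for `x ↦ x ^ (p / n)`, concave because `p ≤ n`, applied to the minimum of `N` uniforms,
whose mean is `1 / (N + 1)`. -/
theorem integral_minRoot_pow_le {n N p : ℕ} (hN : N ≠ 0) (hn : n ≠ 0) (hpn : p ≤ n) :
    ∫ v in Ioo (0 : ℝ) 1, minRoot n N v ^ p ≤ (1 / ((N : ℝ) + 1)) ^ ((p : ℝ) / n) := by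
  have hn' : (0 : ℝ) < n := by positivity
  have : IsProbabilityMeasure (volume.restrict (Ioo (0 : ℝ) 1)) := ⟨by simp⟩
  have hmem : ∀ᵐ v ∂volume.restrict (Ioo (0 : ℝ) 1), v ∈ Ioo (0 : ℝ) 1 :=
    ae_restrict_mem measurableSet_Ioo
  have hq1 : (p : ℝ) / n ≤ 1 := (div_le_one hn').2 (by exact_mod_cast hpn)
  have hi : Integrable (fun v : ℝ => 1 - v ^ (1 / (N : ℝ))) (volume.restrict (Ioo (0 : ℝ) 1)) := by
    refine Integrable.of_bound (by fun_prop) 1 ?_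
    filter_upwards [hmem] with v hv
    have := one_sub_rpow_mem (N := N) hv
    rw [Real.norm_of_nonneg this.1]; exact this.2
  have hi' : Integrable ((fun x : ℝ => x ^ ((p : ℝ) / n)) ∘ fun v : ℝ => 1 - v ^ (1 / (N : ℝ)))
      (volume.restrict (Ioo (0 : ℝ) 1)) := by
    refine Integrable.of_bound ((measurable_id.pow_const _).comp (by fun_prop)).aestronglyMeasurable 1 ?_
    filter_upwards [hmem] with v hv
    have := one_sub_rpow_mem (N := N) hv
    rw [Function.comp, Real.norm_of_nonneg (Real.rpow_nonneg this.1 _)]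
    exact Real.rpow_le_one this.1 this.2 (by positivity)
  have := (Real.concaveOn_rpow (p := (p : ℝ) / n) (by positivity) hq1).le_map_integral
    (Real.continuous_rpow_const (by positivity)).continuousOn isClosed_Ici
    (hmem.mono fun v hv => (one_sub_rpow_mem (N := N) hv).1) hi hi'
  rw [integral_one_sub_rpow hN] at this
  refine (integral_congr_ae ?_).trans_le this
  filter_upwards [hmem] with v hv
  rw [minRoot, ← Real.rpow_natCast, ← Real.rpow_mul (one_sub_rpow_mem hv).1]
  congr 1
  field_simp

end MinimumOfUniforms

/-- Stochastic domination of nonnegative variables gives domination of moments. -/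
theorem lintegral_pow_le_of_meas_lt_le {α β : Type*} [MeasurableSpace α] [MeasurableSpace β]
    {μ : Measure α} {ν : Measure β} {f : α → ℝ} {g : β → ℝ} (hf : 0 ≤ᵐ[μ] f)
    (hfm : AEMeasurable f μ) (hg : 0 ≤ᵐ[ν] g) (hgm : AEMeasurable g ν) {p : ℕ} (hp : p ≠ 0)
    (h : ∀ t, 0 < t → μ {a | t < f a} ≤ ν {b | t < g b}) :
    ∫⁻ a, ENNReal.ofReal (f a ^ p) ∂μ ≤ ∫⁻ b, ENNReal.ofReal (g b ^ p) ∂ν := by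
  have hp' : (0 : ℝ) < p := by positivity
  -- Layer-cake formula: both moments are integrals of the tails against the same weight.
  have h1 := lintegral_rpow_eq_lintegral_meas_lt_mul μ hf hfm hp'
  have h2 := lintegral_rpow_eq_lintegral_meas_lt_mul ν hg hgm hp'
  simp only [Real.rpow_natCast] at h1 h2
  rw [h1, h2]
  gcongr ENNReal.ofReal p * ?_
  refine setLIntegral_mono' measurableSet_Ioi fun t ht => ?_
  gcongr
  exact h t ht

/-! ### The random run -/

namespace IsRCPRun

variable {Ω : Type*} [MeasurableSpace Ω] {n N : ℕ} {c : EuclideanSpace ℝ (Fin n)}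
  {X : Set (EuclideanSpace ℝ (Fin n))} {P : Measure Ω}
  {sample : ℕ → Ω → Fin N → EuclideanSpace ℝ (Fin n)} {z : ℕ → Ω → EuclideanSpace ℝ (Fin n)}

theorem samplePast_le (h : IsRCPRun c X P sample z) (k : ℕ) :
    samplePast sample k ≤ (inferInstance : MeasurableSpace Ω) :=
  iSup₂_le fun j _ => (h.measurable_sample j).comap_le

/-- Rewrites a tail event of the minimum as a box event for the samples, whose product measure is an
`N`-th power. It also makes the gap measurable although `z k` itself need not be. -/
theorem lt_gap_iff (h : IsRCPRun c X P sample z) (k : ℕ) (t : ℝ) (ω : Ω) :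
    t < gap c X z k ω ↔ ∀ i, sample k ω i ∈ {x | t < inner ℝ c x - optValue c X} := by
  constructor
  · intro ht i
    have := h.z_le k ω i
    exact ht.trans_le (sub_le_sub_right this _)
  · intro ht
    obtain ⟨i, hi⟩ := h.z_mem k ω
    have := ht i
    rwa [← hi] at this

theorem measurableSet_gt (c : EuclideanSpace ℝ (Fin n)) (X : Set (EuclideanSpace ℝ (Fin n)))
    (t : ℝ) : MeasurableSet {x | t < inner ℝ c x - optValue c X} :=
  measurableSet_lt measurable_const (by fun_prop)

theorem measurable_gap (h : IsRCPRun c X P sample z) (k : ℕ) : Measurable (gap c X z k) := by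
  refine measurable_of_Ioi fun t => ?_
  have : gap c X z k ⁻¹' Ioi t
      = sample k ⁻¹' (Set.univ.pi fun _ : Fin N => {x | t < inner ℝ c x - optValue c X}) := by
    ext ω
    rw [mem_preimage, mem_Ioi, h.lt_gap_iff]
    simp
  rw [this]
  exact h.measurable_sample k (MeasurableSet.univ_pi fun _ => measurableSet_gt c X t)

variable [IsProbabilityMeasure P]

theorem measure_sample_pi (h : IsRCPRun c X P sample z) (k : ℕ)
    {A : Set (EuclideanSpace ℝ (Fin n))} (hA : MeasurableSet A) :
    P {ω | ∀ i, sample k ω i ∈ A} = ∫⁻ ω,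
      ((volume : Measure (EuclideanSpace ℝ (Fin n)))[|cutBody c X (fun j => z j ω) k] A) ^ N ∂P := by
  have hB : MeasurableSet (Set.univ.pi fun _ : Fin N => A) :=
    MeasurableSet.univ_pi fun _ => hA
  have hpre := h.measurable_sample k hB
  have hlaw := h.sample_law k _ hB
  have hset : {ω | ∀ i, sample k ω i ∈ A} = sample k ⁻¹' (Set.univ.pi fun _ : Fin N => A) := by
    ext ω; simp
  have hint := integral_condExp (μ := P) (h.samplePast_le k)
    (f := (sample k ⁻¹' (Set.univ.pi fun _ : Fin N => A)).indicator fun _ => (1 : ℝ))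
  rw [integral_congr_ae hlaw, integral_indicator_const _ hpre, smul_eq_mul, mul_one] at hint
  -- Integrability in `ω` is inherited from the conditional expectation, so no measurability of the
  -- random body is needed.
  have hi := (integrable_congr hlaw).1 integrable_condExp
  rw [hset, ← ofReal_measureReal (measure_ne_top _ _), ← hint,
    ofReal_integral_eq_lintegral_ofReal hi (ae_of_all _ fun _ => measureReal_nonneg)]
  refine lintegral_congr fun ω => ?_
  rw [ofReal_measureReal (measure_ne_top _ _), Measure.pi_pi]
  simp

theorem ae_sample_mem (h : IsRCPRun c X P sample z) (hX : IsCompact X) (k : ℕ) :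
    ∀ᵐ ω ∂P, ∀ i, sample k ω i ∈ X := by
  have hm : MeasurableSet {ω | ∀ i, sample k ω i ∈ X} := by
    have : {ω | ∀ i, sample k ω i ∈ X} = sample k ⁻¹' (Set.univ.pi fun _ : Fin N => X) := by
      ext ω; simp
    rw [this]
    exact h.measurable_sample k (MeasurableSet.univ_pi fun _ => hX.measurableSet)
  refine (mem_ae_iff_prob_eq_one hm).2 ?_
  -- Taking the whole space shows that the `N`-th powers of the total masses integrate to `1`; since
  -- each body lies in `X`, replacing the whole space by `X` changes nothing.
  have h1 := h.measure_sample_pi k MeasurableSet.univ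
  simp only [mem_univ, implies_true, ofPred_true, measure_univ] at h1
  rw [h.measure_sample_pi k hX.measurableSet, h1]
  refine lintegral_congr fun ω => ?_
  have hS := (cutBody_isCompact c hX (fun j => z j ω) k).measurableSet
  rw [cond_apply hS, cond_apply hS, inter_univ, inter_eq_self_of_subset_left (cutBody_subset ..)]

theorem ae_z_mem (h : IsRCPRun c X P sample z) (hX : IsCompact X) (k : ℕ) :
    ∀ᵐ ω ∂P, z k ω ∈ X := by
  filter_upwards [h.ae_sample_mem hX k] with ω hω
  obtain ⟨i, hi⟩ := h.z_mem k ω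
  exact hi ▸ hω i

theorem ae_gap_nonneg (h : IsRCPRun c X P sample z) (hX : IsCompact X) (k : ℕ) :
    0 ≤ᵐ[P] gap c X z k := by
  filter_upwards [h.ae_z_mem hX k] with ω hω
  obtain ⟨x₀, -, -, hle⟩ := exists_eq_optValue (c := c) hX ⟨_, hω⟩
  exact sub_nonneg.2 (hle _ hω)

theorem integrable_gap_pow (h : IsRCPRun c X P sample z) (hX : IsCompact X) (k p : ℕ) :
    Integrable (fun ω => gap c X z k ω ^ p) P := by
  obtain ⟨C, hC⟩ := hX.exists_bound_of_continuousOn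
    (f := fun x => (inner ℝ c x - optValue c X) ^ p) (by fun_prop)
  refine Integrable.of_bound ((h.measurable_gap k).pow_const p).aestronglyMeasurable C ?_
  filter_upwards [h.ae_z_mem hX k] with ω hω
  exact hC _ hω

/-- By Fubini it suffices to compare, for each fixed `ω`, the bound from the cut with the tail of
`minRoot` at `a = t / gap`. -/
theorem measure_lt_gap_succ_le (h : IsRCPRun c X P sample z) (hn : n ≠ 0) (hN : N ≠ 0)
    (hconv : Convex ℝ X) (hX : IsCompact X) (hne : X.Nonempty) (k : ℕ) {t : ℝ} (ht : 0 < t) :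
    P {ω | t < gap c X z (k + 1) ω} ≤
      (P.prod (volume.restrict (Ioo (0 : ℝ) 1)))
        {q | t < gap c X z k q.1 * minRoot n N q.2} := by
  have hm : MeasurableSet {q : Ω × ℝ | t < gap c X z k q.1 * minRoot n N q.2} :=
    measurableSet_lt measurable_const
      (((h.measurable_gap k).comp measurable_fst).mul
        ((measurable_minRoot n N).comp measurable_snd))
  simp only [h.lt_gap_iff (k + 1) t]
  rw [h.measure_sample_pi _ (measurableSet_gt c X t), Measure.prod_apply hm]
  refine lintegral_mono fun ω => ?_
  refine (pow_le_pow_left' (cond_cutBody_gt_le hconv hX hne _ k ht) N).trans ?_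
  split_ifs with hlt
  · change t < gap c X z k ω at hlt
    have hg : 0 < gap c X z k ω := ht.trans hlt
    refine (volume_lt_minRoot_ge hn hN (a := t / gap c X z k ω)
      ⟨by positivity, (div_lt_one hg).2 hlt⟩).trans (measure_mono fun v hv => ?_)
    exact (div_lt_iff₀' hg).1 hv
  · simp [hN]

/-- One iteration contracts the `p`-th moment of the gap, for `p ≤ n`. -/
theorem integral_gap_succ_pow_le (h : IsRCPRun c X P sample z) (hn : n ≠ 0) (hN : N ≠ 0)
    (hconv : Convex ℝ X) (hX : IsCompact X) (hne : X.Nonempty) {p : ℕ} (hp : p ≠ 0) (hpn : p ≤ n)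
    (k : ℕ) :
    ∫ ω, gap c X z (k + 1) ω ^ p ∂P
      ≤ (1 / ((N : ℝ) + 1)) ^ ((p : ℝ) / n) * ∫ ω, gap c X z k ω ^ p ∂P := by
  have hu : ∀ᵐ v ∂volume.restrict (Ioo (0 : ℝ) 1), minRoot n N v ∈ Icc (0 : ℝ) 1 :=
    (ae_restrict_mem measurableSet_Ioo).mono fun v hv => minRoot_mem hv
  have hprod : ∀ᵐ q ∂P.prod (volume.restrict (Ioo (0 : ℝ) 1)),
      0 ≤ gap c X z k q.1 * minRoot n N q.2 := by
    filter_upwards [Measure.quasiMeasurePreserving_fst.ae (h.ae_gap_nonneg hX k),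
      Measure.quasiMeasurePreserving_snd.ae hu] with q h1 h2
    exact mul_nonneg h1 h2.1
  have hi : Integrable (fun v => minRoot n N v ^ p) (volume.restrict (Ioo (0 : ℝ) 1)) := by
    refine Integrable.of_bound ((measurable_minRoot n N).pow_const p).aestronglyMeasurable 1 ?_
    filter_upwards [hu] with v hv
    rw [Real.norm_of_nonneg (pow_nonneg hv.1 p)]
    exact pow_le_one₀ hv.1 hv.2
  have hi2 : Integrable (fun q : Ω × ℝ => (gap c X z k q.1 * minRoot n N q.2) ^ p)
      (P.prod (volume.restrict (Ioo (0 : ℝ) 1))) := by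
    simpa only [mul_pow] using (h.integrable_gap_pow hX k p).mul_prod hi
  have hl := lintegral_pow_le_of_meas_lt_le (h.ae_gap_nonneg hX (k + 1))
    (h.measurable_gap (k + 1)).aemeasurable hprod
    (((h.measurable_gap k).comp measurable_fst).mul
        ((measurable_minRoot n N).comp measurable_snd)).aemeasurable hp
    (fun t ht => h.measure_lt_gap_succ_le hn hN hconv hX hne k ht)
  have hnn (j : ℕ) : 0 ≤ᵐ[P] fun ω => gap c X z j ω ^ p :=
    (h.ae_gap_nonneg hX j).mono fun ω hω => pow_nonneg hω p
  have hnn2 := hprod.mono fun q hq => pow_nonneg hq p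
  rw [← ofReal_integral_eq_lintegral_ofReal (h.integrable_gap_pow hX _ p) (hnn _),
    ← ofReal_integral_eq_lintegral_ofReal hi2 hnn2,
    ENNReal.ofReal_le_ofReal_iff (integral_nonneg_of_ae hnn2)] at hl
  refine hl.trans ?_
  simp only [mul_pow]
  rw [integral_prod_mul (fun ω => gap c X z k ω ^ p) (fun v => minRoot n N v ^ p), mul_comm]
  exact mul_le_mul_of_nonneg_right (integral_minRoot_pow_le hN hn hpn)
    (integral_nonneg_of_ae (hnn k))

theorem integral_gap_pow_le (h : IsRCPRun c X P sample z) (hn : n ≠ 0) (hN : N ≠ 0)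
    (hconv : Convex ℝ X) (hX : IsCompact X) (hne : X.Nonempty) {p : ℕ} (hp : p ≠ 0) (hpn : p ≤ n)
    (k : ℕ) :
    ∫ ω, gap c X z k ω ^ p ∂P
      ≤ (1 / ((N : ℝ) + 1)) ^ ((p : ℝ) * k / n) * ∫ ω, gap c X z 0 ω ^ p ∂P := by
  induction k with
  | zero => simp
  | succ k ih =>
    refine (h.integral_gap_succ_pow_le hn hN hconv hX hne hp hpn k).trans ?_
    refine (mul_le_mul_of_nonneg_left ih (by positivity)).trans_eq ?_
    rw [← mul_assoc, ← Real.rpow_add (by positivity)]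
    congr 2
    push_cast
    ring

end IsRCPRun

theorem mainTheorem3 {n N : ℕ} (hn : 1 ≤ n) (hN : 1 ≤ N)
    (c : EuclideanSpace ℝ (Fin n)) (X : Set (EuclideanSpace ℝ (Fin n)))
    (hconv : Convex ℝ X) (hcomp : IsCompact X) (hint : (interior X).Nonempty)
    {Ω : Type*} [MeasurableSpace Ω] (P : Measure Ω) [IsProbabilityMeasure P]
    (sample : ℕ → Ω → Fin N → EuclideanSpace ℝ (Fin n))
    (z : ℕ → Ω → EuclideanSpace ℝ (Fin n))
    (hrun : IsRCPRun c X P sample z) (k : ℕ) :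
    (Integrable (gap c X z k) P ∧
      ∫ ω, gap c X z k ω ∂P
        ≤ (1 / ((N : ℝ) + 1)) ^ ((k : ℝ) / (n : ℝ)) * ∫ ω, gap c X z 0 ω ∂P) ∧
    (Integrable (fun ω => gap c X z k ω ^ 2) P ∧
      (2 ≤ n → ∫ ω, gap c X z k ω ^ 2 ∂P
        ≤ (1 / ((N : ℝ) + 1)) ^ (2 * (k : ℝ) / (n : ℝ)) * ∫ ω, gap c X z 0 ω ^ 2 ∂P)) := by
  have hn' : n ≠ 0 := Nat.one_le_iff_ne_zero.1 hn
  have hN' : N ≠ 0 := Nat.one_le_iff_ne_zero.1 hN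
  have hne : X.Nonempty := hint.mono interior_subset
  refine ⟨⟨?_, ?_⟩, hrun.integrable_gap_pow hcomp k 2, fun hn2 => ?_⟩
  · simpa using hrun.integrable_gap_pow hcomp k 1
  · simpa using hrun.integral_gap_pow_le hn' hN' hconv hcomp hne one_ne_zero hn k
  · simpa using hrun.integral_gap_pow_le hn' hN' hconv hcomp hne two_ne_zero hn2 k
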